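/- Let $0\le k\le n$, let $\mathbb S^n$ be the Euclidean space of real symmetric $n\times n$ matrices with the inner product $\langle A,B\rangle=\operatorname{tr}(A^{\mathsf T}B)$, and let $$\mathrm{Gr}(k,n)=\{Q\in\mathbb S^n: Q^2=I,\ \operatorname{tr}Q=2k-n\}\subseteq\mathbb S^n .$$ For $Q\in \mathrm{Gr}(k,n)$ let $\mathbb T_Q$ be the tangent space (the space of velocities at $Q$ of smooth curves in $\mathrm{Gr}(k,n)$ through $Q$) and $\mathbb N_Q=\mathbb T_Q^\perp$ its orthogonal complement in $\mathbb S^n$. The second fundamental form $\mathsf{II}_Q:\mathbb T_Q\times\mathbb T_Q\to\mathbb N_Q$ is $$\mathsf{II}_Q(X,Y)=\operatorname{proj}_{\mathbb N_Q}(\partial_X \vec Y),$$ where $\vec Y$ is any smooth vector field on a neighbourhood of $Q$ in $\mathbb S^n$ that is tangent to $\mathrm{Gr}(k,n)$ along $\mathrm{Gr}(k,n)$ and satisfies $\vec Y(Q)=Y$. Every $Q\in\mathrm{Gr}(k,n)$ can be written as $Q=V\begin{bmatrix} I_k&0\\0&-I_{n-k}\end{bmatrix}V^{\mathsf T}$ with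 $V$ orthogonal. For every such $V$, $$\mathbb T_Q=\left\{V\begin{bmatrix}0&X_0\\X_0^{\mathsf T}&0\end{bmatrix}V^{\mathsf T}: X_0\in\mathbb R^{k\times(n-k)}\right\},$$ and for all $X=V\begin{bmatrix}0&X_0\\X_0^{\mathsf T}&0\end{bmatrix}V^{\mathsf T}$ and $Y=V\begin{bmatrix}0&Y_0\\Y_0^{\mathsf T}&0\end{bmatrix}V^{\mathsf T}$ in $\mathbb T_Q$, a vector field $\vec Y$ as above exists, $\operatorname{proj}_{\mathbb N_Q}(\partial_X \vec Y)$ does not depend on its choice, and $$\mathsf{II}_Q(X,Y)=\frac12\,V\begin{bmatrix}-(X_0Y_0^{\mathsf T}+Y_0X_0^{\mathsf T})&0\\0&X_0^{\mathsf T}Y_0+Y_0^{\mathsf T}X_0\end{bmatrix}V^{\mathsf T}.$$ Moreover $\mathsf{II}_Q(X,Y)=(d_Q\mathsf\Gamma(X))(Y)$, where $\mathsf\Gamma: R\mapsto\mathbb N_R$ is the Gauss map and its differential is read in $\mathrm{Hom}(\mathbb T_Q,\mathbb N_Q)$ by identifying $\mathbb N_R$ with its complement $\mathbb T_R$; that is,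 $\mathsf{II}_Q(X,Y)$ is the derivative at $t=0$ of $\operatorname{proj}_{\mathbb T_{\gamma(t)}}(Y)$ for every smooth curve $\gamma$ in $\mathrm{Gr}(k,n)$ with $\gamma(0)=Q$ and $\gamma'(0)=X$. -/

import Mathlib

open scoped ContDiff

/-! ### Extrinsic geometry of a submanifold of a Euclidean space -/

section Extrinsic

variable {E : Type*} [NormedAddCommGroup E] [InnerProductSpace ℝ E]

/-- `γ` is a smooth curve lying in `M` that passes through `x` at time `0` with velocity `v`. -/
structure IsCurveThrough (M : Set E) (x v : E) (γ : ℝ → E) : Prop where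
  smooth : ContDiff ℝ ∞ γ
  mem : ∀ t, γ t ∈ M
  start : γ 0 = x
  velocity : deriv γ 0 = v

/-- The velocities at `x` of the smooth curves in `M` through `x`. -/
def tangentVectors (M : Set E) (x : E) : Set E :=
  {v | ∃ γ : ℝ → E, IsCurveThrough M x v γ}

/-- The tangent space of `M` at `x`, as a subspace of the ambient Euclidean space. (For a
submanifold the velocities already form a subspace, so that the span adds nothing.) -/
def tangentSpace (M : Set E) (x : E) : Submodule ℝ E :=
  Submodule.span ℝ (tangentVectors M x)

/-- The normal space of `M` at `x`. -/
noncomputable def normalSpace (M : Set E) (x : E) : Submodule ℝ E := (tangentSpace M x)ᗮ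

/-- The Gauss map of `M`, sending a point to its normal space. -/
noncomputable def gaussMap (M : Set E) : E → Submodule ℝ E := fun x => normalSpace M x

/-- `W` is a smooth vector field on a neighbourhood of `x` in the ambient space which is tangent to
`M` along `M` and has the value `w` at `x`; that is, `W` extends a smooth local vector field of `M`
with value `w` at `x`. -/
def IsTangentExtension (M : Set E) (x w : E) (W : E → E) : Prop :=
  ∃ U : Set E, IsOpen U ∧ x ∈ U ∧ ContDiffOn ℝ ∞ W U ∧
    (∀ y ∈ M ∩ U, W y ∈ tangentSpace M y) ∧ W x = w

variable [FiniteDimensional ℝ E]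

open Classical in
/-- The second fundamental form of `M` at `x`: the normal component `proj_N (∂_v W)` of the
derivative in the direction `v` of a smooth vector field `W` of `M` with `W x = w`. -/
noncomputable def secondFundamentalForm (M : Set E) (x v w : E) : E :=
  if h : ∃ W : E → E, IsTangentExtension M x w W then
    (normalSpace M x).starProjection (fderiv ℝ h.choose x v)
  else 0

/-- The value of the second fundamental form at `(v, w)` is well defined: `w` extends to a smooth
vector field of `M` near `x`, and all extensions lead to the same value. -/
def SecondFundamentalFormWellDefined (M : Set E) (x v w : E) : Prop :=
  (∃ W : E → E, IsTangentExtension M x w W) ∧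
    ∀ W : E → E, IsTangentExtension M x w W →
      (normalSpace M x).starProjection (fderiv ℝ W x v) = secondFundamentalForm M x v w

/-- `L` is the differential at `x`, in the direction `v`, of the Gauss map.

Identify a normal space `N_y` with its complement `N_yᗮ = T_y`, and a subspace with the orthogonal
projection onto it. A curve `t ↦ U t` of subspaces with `U 0 = T_x` has a velocity in
`Hom(T_x, N_x)`, which sends `w` to the value at `w` of the derivative of the orthogonal projections
onto `U t`. So `L` restricted to `T_x` is `d_x Γ(v) ∈ Hom(T_x, N_x)`. -/
def HasGaussDifferential (M : Set E) (x v : E) (L : E →L[ℝ] E) : Prop :=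
  (∃ γ : ℝ → E, IsCurveThrough M x v γ) ∧
    ∀ γ : ℝ → E, IsCurveThrough M x v γ →
      HasDerivAt (fun t : ℝ => ((gaussMap M (γ t))ᗮ).starProjection) L 0

end Extrinsic

/-! ### Symmetric matrices with the trace inner product -/

/-- The subspace of symmetric matrices in all real `n × n` matrices. -/
def symSubmodule (n : ℕ) : Submodule ℝ (Matrix (Fin n) (Fin n) ℝ) where
  carrier := {A | A.transpose = A}
  add_mem' {A B} hA hB := by
    change (A + B).transpose = A + B
    rw [Matrix.transpose_add, show A.transpose = A from hA, show B.transpose = B from hB]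
  zero_mem' := Matrix.transpose_zero
  smul_mem' c A hA := by
    change (c • A).transpose = c • A
    rw [Matrix.transpose_smul, show A.transpose = A from hA]

/-- The space `𝕊ⁿ` of real symmetric `n × n` matrices. -/
def SymMat (n : ℕ) : Type := symSubmodule n

namespace SymMat

variable {n : ℕ}

noncomputable instance : AddCommGroup (SymMat n) := inferInstanceAs (AddCommGroup (symSubmodule n))

noncomputable instance : Module ℝ (SymMat n) := inferInstanceAs (Module ℝ (symSubmodule n))

instance : FiniteDimensional ℝ (SymMat n) :=
  inferInstanceAs (FiniteDimensional ℝ (symSubmodule n))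

/-- The inclusion of the symmetric matrices in all matrices. -/
noncomputable def toMatrix : SymMat n →ₗ[ℝ] Matrix (Fin n) (Fin n) ℝ :=
  (symSubmodule n).subtype

theorem toMatrix_injective : Function.Injective (toMatrix (n := n)) := Subtype.val_injective

theorem transpose_toMatrix (A : SymMat n) : (toMatrix A).transpose = toMatrix A := A.2

/-- Every matrix that equals its transpose is an element of `𝕊ⁿ`. -/
theorem exists_toMatrix_eq (A : Matrix (Fin n) (Fin n) ℝ) (hA : A.transpose = A) :
    ∃ S : SymMat n, toMatrix S = A := ⟨⟨A, hA⟩, rfl⟩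

/-- The trace inner product `⟨A, B⟩ = tr(Aᵀ B)`. -/
@[reducible] noncomputable def innerCore : InnerProductSpace.Core ℝ (SymMat n) where
  inner A B := ((toMatrix A).transpose * toMatrix B).trace
  conj_inner_symm A B := by
    simp only [conj_trivial]
    rw [← Matrix.trace_transpose, Matrix.transpose_mul, Matrix.transpose_transpose]
  re_inner_nonneg A := by
    rw [RCLike.re_to_real]
    simp only [Matrix.trace, Matrix.diag_apply, Matrix.mul_apply, Matrix.transpose_apply]
    exact Finset.sum_nonneg fun i _ => Finset.sum_nonneg fun j _ =>
      mul_self_nonneg (toMatrix A j i)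
  add_left A B C := by
    simp only [map_add, Matrix.transpose_add, Matrix.add_mul, Matrix.trace_add]
  smul_left A B r := by
    simp [Matrix.trace_smul]
  definite A hA := by
    have h : toMatrix A = 0 := Matrix.trace_conjTranspose_mul_self_eq_zero_iff.mp
      (by simpa using hA)
    exact toMatrix_injective (by simpa using h)

noncomputable instance : NormedAddCommGroup (SymMat n) :=
  @InnerProductSpace.Core.toNormedAddCommGroup ℝ (SymMat n) _ _ _ innerCore

noncomputable instance : InnerProductSpace ℝ (SymMat n) := InnerProductSpace.ofCore innerCore.toCore

theorem inner_def (A B : SymMat n) :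
    inner ℝ A B = ((toMatrix A).transpose * toMatrix B).trace := rfl

end SymMat

/-! ### The involution model -/

/-- The involution model `Gr(k, n) = {Q ∈ 𝕊ⁿ : Q² = I, tr Q = 2k - n}` of the Grassmannian. -/
def involutionGr (k n : ℕ) : Set (SymMat n) :=
  {Q | SymMat.toMatrix Q * SymMat.toMatrix Q = 1 ∧
    (SymMat.toMatrix Q).trace = 2 * (k : ℝ) - (n : ℝ)}

/-- The `n × n` matrix with the blocks `A, B, C, D`, where `n` is split as `k + (n - k)`: the first
`k` rows and columns come first. -/
def blockMatrix {k n : ℕ} (hk : k ≤ n) (A : Matrix (Fin k) (Fin k) ℝ)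
    (B : Matrix (Fin k) (Fin (n - k)) ℝ) (C : Matrix (Fin (n - k)) (Fin k) ℝ)
    (D : Matrix (Fin (n - k)) (Fin (n - k)) ℝ) : Matrix (Fin n) (Fin n) ℝ :=
  let e : Fin k ⊕ Fin (n - k) ≃ Fin n :=
    finSumFinEquiv.trans (finCongr (Nat.add_sub_of_le hk))
  Matrix.reindex e e (Matrix.fromBlocks A B C D)

/-! Everything follows from Q² = I without coordinates. Differentiating it gives QX + XQ = 0 for
tangent X; conversely, conjugating Q by a one-parameter group of rotations attains every such X, so
these X are the tangent space (`mem_tangentSpace_iff`). The projection onto it, Y ↦ (Y - QYQ)/2, is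
polynomial in Q (`starProjection_tangentSpace`), hence it yields tangent extensions and can be
differentiated along curves.

For any tangent field W with W(Q) = Y, differentiating γW(γ) + W(γ)γ = 0 determines the normal part
of ∂_X W as -(QYX + XYQ)/2, whatever W is (`starProjection_normalSpace_fderiv`). The derivative of
the projections, applied to Y, is the same expression (`hasGaussDifferential`). Blocks enter last:
in an orthonormal eigenbasis of Q the formula is block multiplication. -/

namespace SymMat

variable {n : ℕ}

/-! ### Jordan products on symmetric matrices -/

@[ext]
theorem ext {A B : SymMat n} (h : toMatrix A = toMatrix B) : A = B := toMatrix_injective h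

/-- The symmetric part `(A + Aᵀ) / 2` of a square matrix. -/
noncomputable def symPart : Matrix (Fin n) (Fin n) ℝ →ₗ[ℝ] SymMat n :=
  LinearMap.codRestrict (symSubmodule n)
    ((1 / 2 : ℝ) • (LinearMap.id + (Matrix.transposeLinearEquiv (Fin n) (Fin n) ℝ ℝ).toLinearMap))
    (fun A => by
      change ((1 / 2 : ℝ) • (A + A.transpose)).transpose = (1 / 2 : ℝ) • (A + A.transpose)
      rw [Matrix.transpose_smul, Matrix.transpose_add, Matrix.transpose_transpose, add_comm])

theorem toMatrix_symPart (A : Matrix (Fin n) (Fin n) ℝ) :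
    toMatrix (symPart A) = (1 / 2 : ℝ) • (A + A.transpose) := rfl

theorem toMatrix_symPart_of_isSymm {A : Matrix (Fin n) (Fin n) ℝ} (hA : A.transpose = A) :
    toMatrix (symPart A) = A := by
  rw [toMatrix_symPart, hA, ← two_smul ℝ A, smul_smul]
  norm_num

theorem symPart_toMatrix (A : SymMat n) : symPart (toMatrix A) = A :=
  ext (toMatrix_symPart_of_isSymm (transpose_toMatrix A))

/-- The Jordan product `(AB + BA) / 2` of symmetric matrices. -/
noncomputable def jordan : SymMat n →L[ℝ] SymMat n →L[ℝ] SymMat n :=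
  LinearMap.toContinuousBilinearMap
    (LinearMap.mk₂ ℝ (fun A B : SymMat n => symPart (toMatrix A * toMatrix B))
      (fun A A' B => by simp [add_mul]) (fun c A B => by simp)
      (fun A B B' => by simp [mul_add]) (fun c A B => by simp))

theorem toMatrix_jordan (A B : SymMat n) :
    toMatrix (jordan A B) =
      (1 / 2 : ℝ) • (toMatrix A * toMatrix B + toMatrix B * toMatrix A) := by
  change toMatrix (symPart (toMatrix A * toMatrix B)) = _
  rw [toMatrix_symPart, Matrix.transpose_mul, transpose_toMatrix, transpose_toMatrix]

theorem jordan_eq_zero_iff {A B : SymMat n} :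
    jordan A B = 0 ↔ toMatrix A * toMatrix B + toMatrix B * toMatrix A = 0 := by
  rw [← toMatrix_injective.eq_iff, toMatrix_jordan, map_zero, smul_eq_zero]
  norm_num

/-- The Jordan triple product `C ↦ (ACB + BCA) / 2` of symmetric matrices. -/
noncomputable def triple : SymMat n →L[ℝ] SymMat n →L[ℝ] (SymMat n →L[ℝ] SymMat n) :=
  LinearMap.toContinuousBilinearMap
    (LinearMap.mk₂ ℝ (fun A B : SymMat n => LinearMap.toContinuousLinearMap
        (symPart ∘ₗ LinearMap.mulLeft ℝ (toMatrix A) ∘ₗ LinearMap.mulRight ℝ (toMatrix B) ∘ₗ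
          toMatrix))
      (fun A A' B => by ext C : 2; simp [add_mul]) (fun c A B => by ext C : 2; simp)
      (fun A B B' => by ext C : 2; simp [mul_add]) (fun c A B => by ext C : 2; simp))

theorem toMatrix_triple (A B C : SymMat n) :
    toMatrix (triple A B C) =
      (1 / 2 : ℝ) • (toMatrix A * toMatrix C * toMatrix B +
        toMatrix B * toMatrix C * toMatrix A) := by
  change toMatrix (symPart (toMatrix A * (toMatrix C * toMatrix B))) = _
  rw [toMatrix_symPart, Matrix.transpose_mul, Matrix.transpose_mul, transpose_toMatrix,
    transpose_toMatrix, transpose_toMatrix, mul_assoc (toMatrix A)]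

theorem toMatrix_triple_self (A C : SymMat n) :
    toMatrix (triple A A C) = toMatrix A * toMatrix C * toMatrix A := by
  rw [toMatrix_triple, ← two_smul ℝ (_ * _), smul_smul]
  norm_num

/-! ### Tangent and normal spaces -/

open scoped Matrix.Norms.Operator in
/-- Conjugating an involution `Q` by `exp (tXQ/2)` gives a smooth curve of involutions with
velocity `X`, whenever `X` is symmetric and anticommutes with `Q`. -/
theorem exists_isCurveThrough {k : ℕ} {Q X : SymMat n} (hQ : Q ∈ involutionGr k n)
    (hX : jordan Q X = 0) : ∃ γ : ℝ → SymMat n, IsCurveThrough (involutionGr k n) Q X γ := by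
  set q := toMatrix Q with hq
  set x := toMatrix X with hx
  have hqq : q * q = 1 := hQ.1
  have hxq : x * q = -(q * x) := by
    rw [jordan_eq_zero_iff] at hX
    exact eq_neg_of_add_eq_zero_right hX
  -- Since x anticommutes with q and q² = 1, a is skew and aq - qa = x; so exp(ta) is orthogonal and
  -- the conjugated curve has velocity x.
  set a : Matrix (Fin n) (Fin n) ℝ := (1 / 2 : ℝ) • (x * q) with ha
  have haT : a.transpose = -a := by
    rw [ha, Matrix.transpose_smul, Matrix.transpose_mul, transpose_toMatrix, transpose_toMatrix,
      ← hq, ← hx, hxq, smul_neg, neg_neg]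
  let u : ℝ → Matrix (Fin n) (Fin n) ℝ := fun t => NormedSpace.exp (t • a)
  have huT (t : ℝ) : (u t).transpose = u (-t) := by
    simp only [u]
    rw [← Matrix.exp_transpose, Matrix.transpose_smul, haT, smul_neg, neg_smul]
  have huu (t : ℝ) : u (-t) * u t = 1 := by
    simp only [u]
    rw [← Matrix.exp_add_of_commute _ _ ((Commute.refl a).smul_left _ |>.smul_right _)]
    simp
  have husmooth : ContDiff ℝ ∞ u := by
    have h : ContDiff ℝ ∞ (NormedSpace.exp : Matrix (Fin n) (Fin n) ℝ → _) :=
      contDiff_iff_contDiffAt.2 fun y => (NormedSpace.exp_analytic (𝕂 := ℝ) y).contDiffAt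
    exact h.comp (by fun_prop)
  have hu' : HasDerivAt u a 0 := by
    have h := hasDerivAt_exp_smul_const (𝕂 := ℝ) a (0 : ℝ)
    rwa [zero_smul, NormedSpace.exp_zero, one_mul] at h
  have hv' : HasDerivAt (fun t => u (-t)) (-a) 0 := by
    have h : HasDerivAt u a (-0) := by simpa using hu'
    have h2 := h.scomp (0 : ℝ) (hasDerivAt_neg (0 : ℝ))
    rwa [neg_one_smul] at h2
  let c : ℝ → Matrix (Fin n) (Fin n) ℝ := fun t => u t * q * u (-t)
  have hc (t : ℝ) : toMatrix (symPart (c t)) = c t := by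
    apply toMatrix_symPart_of_isSymm
    simp only [c]
    rw [Matrix.transpose_mul, Matrix.transpose_mul, huT, huT, hq, transpose_toMatrix, neg_neg,
      mul_assoc]
  have hc' : HasDerivAt c x 0 := by
    have h := (hu'.mul_const q).mul hv'
    convert! h using 1
    have h1 : x * q * q = x := by rw [mul_assoc, hqq, mul_one]
    have h2 : q * (x * q) = -x := by rw [hxq, mul_neg, ← mul_assoc, hqq, one_mul]
    simp only [u, neg_zero, zero_smul, NormedSpace.exp_zero, one_mul, mul_one, ha, smul_mul_assoc,
      mul_neg, mul_smul_comm, h1, h2]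
    rw [smul_neg, neg_neg, ← add_smul]
    norm_num
  let S : Matrix (Fin n) (Fin n) ℝ →L[ℝ] SymMat n := LinearMap.toContinuousLinearMap symPart
  refine ⟨fun t => S (c t), ?_, fun t => ⟨?_, ?_⟩, ?_, ?_⟩
  · exact S.contDiff.comp ((husmooth.mul contDiff_const).mul (husmooth.comp contDiff_neg))
  · change toMatrix (symPart (c t)) * toMatrix (symPart (c t)) = 1
    rw [hc]
    calc u t * q * u (-t) * (u t * q * u (-t))
        = u t * (q * (u (-t) * u t) * q) * u (-t) := by simp only [mul_assoc]
      _ = u t * u (-t) := by rw [huu, mul_one, hqq, mul_one]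
      _ = 1 := by simpa using huu (-t)
  · change (toMatrix (symPart (c t))).trace = _
    rw [hc]
    simp only [c]
    rw [mul_assoc, Matrix.trace_mul_comm, mul_assoc, huu, mul_one]
    exact hQ.2
  · change symPart (c 0) = Q
    simp only [c, u, neg_zero, zero_smul, NormedSpace.exp_zero, one_mul, mul_one]
    exact symPart_toMatrix Q
  · have h : HasDerivAt (fun t => S (c t)) (S x) 0 := S.hasFDerivAt.comp_hasDerivAt (0 : ℝ) hc'
    rw [h.deriv]
    exact symPart_toMatrix X

theorem jordan_self_of_mem {k : ℕ} {Q R : SymMat n} (hQ : Q ∈ involutionGr k n)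
    (hR : R ∈ involutionGr k n) : jordan Q Q = jordan R R := by
  ext : 1
  rw [toMatrix_jordan, toMatrix_jordan, hQ.1, hR.1]

theorem jordan_comm (A B : SymMat n) : jordan A B = jordan B A := by
  ext : 1
  rw [toMatrix_jordan, toMatrix_jordan, add_comm]

theorem _root_.IsCurveThrough.hasDerivAt {E : Type*} [NormedAddCommGroup E]
    [InnerProductSpace ℝ E] {M : Set E} {x v : E} {γ : ℝ → E} (h : IsCurveThrough M x v γ) :
    HasDerivAt γ v 0 := by
  rw [← h.velocity]
  exact (h.smooth.differentiable (by simp)).differentiableAt.hasDerivAt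

/-- One inclusion differentiates γ² = I. For the other, each solution is itself a velocity, so the
span adds nothing. -/
theorem mem_tangentSpace_iff {k : ℕ} {Q X : SymMat n} (hQ : Q ∈ involutionGr k n) :
    X ∈ tangentSpace (involutionGr k n) Q ↔ jordan Q X = 0 := by
  constructor
  · intro h
    have hle : tangentSpace (involutionGr k n) Q ≤ LinearMap.ker (jordan Q).toLinearMap := by
      refine Submodule.span_le.2 ?_
      rintro v ⟨γ, hγ⟩
      have h1 := jordan.hasDerivAt_of_bilinear (fun _ => hγ.hasDerivAt) (fun _ => hγ.hasDerivAt)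
      have h2 : (fun t => jordan (γ t) (γ t)) = fun _ => jordan Q Q :=
        funext fun t => jordan_self_of_mem (hγ.mem t) hQ
      rw [h2, hγ.start, jordan_comm v, ← two_smul ℝ] at h1
      have h3 := h1.unique (hasDerivAt_const _ _)
      exact (smul_eq_zero.1 h3).resolve_left two_ne_zero
    exact hle h
  · intro h
    exact Submodule.subset_span (exists_isCurveThrough hQ h)

/-- Over an involution `Q`, the projections onto the tangent space and the normal space are
`Y ↦ (Y - QYQ) / 2` and `Y ↦ (Y + QYQ) / 2`. -/
theorem starProjection_tangentSpace {k : ℕ} {Q : SymMat n} (hQ : Q ∈ involutionGr k n)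
    (Y : SymMat n) : (tangentSpace (involutionGr k n) Q).starProjection Y =
      (1 / 2 : ℝ) • (Y - triple Q Q Y) := by
  have hqq : toMatrix Q * toMatrix Q = 1 := hQ.1
  have hq3 : toMatrix Q * (toMatrix Q * toMatrix Y * toMatrix Q) = toMatrix Y * toMatrix Q := by
    rw [← mul_assoc, ← mul_assoc, hqq, one_mul]
  have hq4 : toMatrix Q * toMatrix Y * toMatrix Q * toMatrix Q = toMatrix Q * toMatrix Y := by
    rw [mul_assoc, hqq, mul_one]
  refine Submodule.eq_starProjection_of_mem_orthogonal ?_ ?_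
  · rw [mem_tangentSpace_iff hQ, jordan_eq_zero_iff, map_smul, map_sub, toMatrix_triple_self,
      mul_smul_comm, smul_mul_assoc, mul_sub, sub_mul, hq3, hq4, ← smul_add]
    simp
  · rw [Submodule.mem_orthogonal]
    intro X hX
    rw [mem_tangentSpace_iff hQ, jordan_eq_zero_iff] at hX
    have hX' : toMatrix X * toMatrix Q = -(toMatrix Q * toMatrix X) :=
      eq_neg_of_add_eq_zero_right hX
    have hY : Y - (1 / 2 : ℝ) • (Y - triple Q Q Y) = (1 / 2 : ℝ) • (Y + triple Q Q Y) := by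
      module
    -- Moving Q past X costs a sign and cyclicity cancels Q², so X is orthogonal to Y + QYQ.
    have htr : (toMatrix X * (toMatrix Q * toMatrix Y * toMatrix Q)).trace =
        -(toMatrix X * toMatrix Y).trace := by
      rw [← mul_assoc, ← mul_assoc, hX', Matrix.trace_mul_comm, neg_mul, mul_neg, ← mul_assoc,
        ← mul_assoc, hqq, one_mul, Matrix.trace_neg]
    rw [hY, inner_smul_right, inner_add_right, inner_def, inner_def, transpose_toMatrix,
      toMatrix_triple_self, htr]
    simp

theorem starProjection_normalSpace {k : ℕ} {Q : SymMat n} (hQ : Q ∈ involutionGr k n)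
    (Y : SymMat n) : (normalSpace (involutionGr k n) Q).starProjection Y =
      (1 / 2 : ℝ) • (Y + triple Q Q Y) := by
  rw [normalSpace, Submodule.starProjection_orthogonal_val, starProjection_tangentSpace hQ]
  module

/-! ### The second fundamental form -/

theorem exists_isTangentExtension {k : ℕ} {Q Y : SymMat n} (hQ : Q ∈ involutionGr k n)
    (hY : Y ∈ tangentSpace (involutionGr k n) Q) :
    ∃ W, IsTangentExtension (involutionGr k n) Q Y W := by
  -- On the Grassmannian this is the tangential projection of the constant Y; the polynomial formula
  -- extends it smoothly to all of 𝕊ⁿ.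
  refine ⟨fun R => (1 / 2 : ℝ) • (Y - triple R R Y), Set.univ, isOpen_univ, trivial, ?_, ?_, ?_⟩
  · refine ContDiff.contDiffOn (ContDiff.const_smul _ (contDiff_const.sub ?_))
    exact (triple.contDiff.clm_apply contDiff_id).clm_apply contDiff_const
  · rintro R ⟨hR, -⟩
    beta_reduce
    rw [← starProjection_tangentSpace hR]
    exact Submodule.starProjection_apply_mem _ _
  · change (1 / 2 : ℝ) • (Y - triple Q Q Y) = Y
    rw [← starProjection_tangentSpace hQ]
    exact Submodule.starProjection_eq_self_iff.2 hY

/-- Tangency is the linear equation γW(γ) + W(γ)γ = 0 along a curve. Its derivative controls QZ + ZQ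
for Z = ∂_X W, which is exactly the normal part of Z up to a factor Q. -/
theorem starProjection_normalSpace_fderiv {k : ℕ} {Q X Y : SymMat n} {W : SymMat n → SymMat n}
    (hQ : Q ∈ involutionGr k n) (hX : X ∈ tangentSpace (involutionGr k n) Q)
    (hW : IsTangentExtension (involutionGr k n) Q Y W) :
    (normalSpace (involutionGr k n) Q).starProjection (fderiv ℝ W Q X) = -triple Q X Y := by
  obtain ⟨U, hU, hQU, hsmooth, htan, hWQ⟩ := hW
  rw [mem_tangentSpace_iff hQ] at hX
  obtain ⟨γ, hγ⟩ := exists_isCurveThrough hQ hX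
  have hWd : HasFDerivAt W (fderiv ℝ W Q) (γ 0) := by
    rw [hγ.start]
    exact ((hsmooth.contDiffAt (hU.mem_nhds hQU)).differentiableAt (by simp)).hasFDerivAt
  have h1 := jordan.hasDerivAt_of_bilinear (fun _ => hγ.hasDerivAt)
    (fun _ => hWd.comp_hasDerivAt (0 : ℝ) hγ.hasDerivAt)
  have h2 : (fun t => jordan (γ t) ((W ∘ γ) t)) =ᶠ[nhds 0] fun _ => 0 := by
    have hc : ContinuousAt γ 0 := hγ.hasDerivAt.continuousAt
    have hev : ∀ᶠ t in nhds 0, γ t ∈ U := hc.eventually (by rw [hγ.start]; exact hU.mem_nhds hQU)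
    filter_upwards [hev] with t ht
    exact (mem_tangentSpace_iff (hγ.mem t)).1 (htan _ ⟨hγ.mem t, ht⟩)
  have h3 := (h1.congr_of_eventuallyEq h2.symm).unique (hasDerivAt_const _ _)
  simp only [Function.comp_apply, hγ.start, hWQ] at h3
  generalize fderiv ℝ W Q X = Z at h3 ⊢
  have hqq : toMatrix Q * toMatrix Q = 1 := hQ.1
  have h4 : toMatrix Q * toMatrix Z + toMatrix Z * toMatrix Q =
      -(toMatrix X * toMatrix Y + toMatrix Y * toMatrix X) := by
    have h5 := congrArg (fun A => (2 : ℝ) • toMatrix A) h3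
    simp only [map_add, toMatrix_jordan, map_zero, smul_zero, smul_add, smul_smul] at h5
    norm_num at h5
    rw [← sub_eq_zero, ← h5]
    abel
  -- Multiplying by Q on the left produces twice the normal projection of Z.
  have h6 : toMatrix Z + toMatrix Q * toMatrix Z * toMatrix Q =
      -(toMatrix Q * toMatrix X * toMatrix Y + toMatrix Q * toMatrix Y * toMatrix X) := by
    calc _ = toMatrix Q * (toMatrix Q * toMatrix Z + toMatrix Z * toMatrix Q) := by
          rw [mul_add, ← mul_assoc, ← mul_assoc, hqq, one_mul]
      _ = _ := by rw [h4, mul_neg, mul_add, mul_assoc, mul_assoc]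
  have hY := htan Q ⟨hQ, hQU⟩
  rw [hWQ, mem_tangentSpace_iff hQ, jordan_eq_zero_iff] at hY
  rw [jordan_eq_zero_iff] at hX
  -- Q anticommutes with both X and Y, so it commutes with XY.
  have h7 : toMatrix Q * toMatrix X * toMatrix Y = toMatrix X * toMatrix Y * toMatrix Q := by
    rw [eq_neg_of_add_eq_zero_left hX, neg_mul, mul_assoc, eq_neg_of_add_eq_zero_left hY,
      mul_neg, neg_neg, mul_assoc]
  rw [starProjection_normalSpace hQ]
  ext : 1
  rw [map_smul, map_add, toMatrix_triple_self, h6, map_neg, toMatrix_triple, h7, add_comm,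
    smul_neg]

theorem secondFundamentalForm_eq {k : ℕ} {Q X Y : SymMat n} (hQ : Q ∈ involutionGr k n)
    (hX : X ∈ tangentSpace (involutionGr k n) Q) (hY : Y ∈ tangentSpace (involutionGr k n) Q) :
    secondFundamentalForm (involutionGr k n) Q X Y = -triple Q X Y := by
  have h := exists_isTangentExtension hQ hY
  rw [secondFundamentalForm, dif_pos h]
  exact starProjection_normalSpace_fderiv hQ hX h.choose_spec

theorem secondFundamentalFormWellDefined {k : ℕ} {Q X Y : SymMat n} (hQ : Q ∈ involutionGr k n)
    (hX : X ∈ tangentSpace (involutionGr k n) Q) (hY : Y ∈ tangentSpace (involutionGr k n) Q) :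
    SecondFundamentalFormWellDefined (involutionGr k n) Q X Y := by
  refine ⟨exists_isTangentExtension hQ hY, fun W hW => ?_⟩
  rw [secondFundamentalForm_eq hQ hX hY]
  exact starProjection_normalSpace_fderiv hQ hX hW

/-! ### The differential of the Gauss map -/

theorem hasGaussDifferential {k : ℕ} {Q X : SymMat n} (hQ : Q ∈ involutionGr k n)
    (hX : X ∈ tangentSpace (involutionGr k n) Q) :
    HasGaussDifferential (involutionGr k n) Q X (-triple Q X) := by
  refine ⟨exists_isCurveThrough hQ ((mem_tangentSpace_iff hQ).1 hX), fun γ hγ => ?_⟩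
  have h1 : (fun t : ℝ => ((gaussMap (involutionGr k n) (γ t))ᗮ).starProjection) =
      fun t => (1 / 2 : ℝ) • (ContinuousLinearMap.id ℝ (SymMat n) - triple (γ t) (γ t)) := by
    ext t Y : 2
    simp only [gaussMap, normalSpace, Submodule.orthogonal_orthogonal]
    exact starProjection_tangentSpace (hγ.mem t) Y
  have h2 := ContinuousLinearMap.hasDerivAt_of_bilinear (G := SymMat n →L[ℝ] SymMat n)
    (B := triple) (fun _ => hγ.hasDerivAt) (fun _ => hγ.hasDerivAt)
  -- By this symmetry the two Leibniz terms agree, which cancels the factor 1/2.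
  have h3 : triple X Q = triple Q X := by
    ext Y : 2
    rw [toMatrix_triple, toMatrix_triple, add_comm]
  rw [h1]
  convert! (h2.const_sub (ContinuousLinearMap.id ℝ (SymMat n))).const_smul (1 / 2 : ℝ) using 1
  rw [hγ.start, h3]
  module

end SymMat

/-! ### Block coordinates -/

section Block

open Matrix

variable {k n : ℕ} (hk : k ≤ n)

theorem blockMatrix_mul (A A' : Matrix (Fin k) (Fin k) ℝ) (B B' : Matrix (Fin k) (Fin (n - k)) ℝ)
    (C C' : Matrix (Fin (n - k)) (Fin k) ℝ) (D D' : Matrix (Fin (n - k)) (Fin (n - k)) ℝ) :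
    blockMatrix hk A B C D * blockMatrix hk A' B' C' D' =
      blockMatrix hk (A * A' + B * C') (A * B' + B * D') (C * A' + D * C') (C * B' + D * D') := by
  simp only [blockMatrix, reindex_apply, submatrix_mul_equiv, fromBlocks_multiply]

theorem blockMatrix_add (A A' : Matrix (Fin k) (Fin k) ℝ) (B B' : Matrix (Fin k) (Fin (n - k)) ℝ)
    (C C' : Matrix (Fin (n - k)) (Fin k) ℝ) (D D' : Matrix (Fin (n - k)) (Fin (n - k)) ℝ) :
    blockMatrix hk A B C D + blockMatrix hk A' B' C' D' =
      blockMatrix hk (A + A') (B + B') (C + C') (D + D') := by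
  simp only [blockMatrix, ← fromBlocks_add]
  rfl

theorem neg_blockMatrix (A : Matrix (Fin k) (Fin k) ℝ) (B : Matrix (Fin k) (Fin (n - k)) ℝ)
    (C : Matrix (Fin (n - k)) (Fin k) ℝ) (D : Matrix (Fin (n - k)) (Fin (n - k)) ℝ) :
    -blockMatrix hk A B C D = blockMatrix hk (-A) (-B) (-C) (-D) := by
  simp only [blockMatrix, ← fromBlocks_neg]
  rfl

theorem transpose_blockMatrix (A : Matrix (Fin k) (Fin k) ℝ) (B : Matrix (Fin k) (Fin (n - k)) ℝ)
    (C : Matrix (Fin (n - k)) (Fin k) ℝ) (D : Matrix (Fin (n - k)) (Fin (n - k)) ℝ) :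
    (blockMatrix hk A B C D)ᵀ = blockMatrix hk Aᵀ Cᵀ Bᵀ Dᵀ := by
  simp only [blockMatrix, transpose_reindex, fromBlocks_transpose]

theorem blockMatrix_zero : blockMatrix hk 0 0 0 0 = 0 := by
  simp [blockMatrix]

theorem blockMatrix_inj {A A' : Matrix (Fin k) (Fin k) ℝ} {B B' : Matrix (Fin k) (Fin (n - k)) ℝ}
    {C C' : Matrix (Fin (n - k)) (Fin k) ℝ} {D D' : Matrix (Fin (n - k)) (Fin (n - k)) ℝ} :
    blockMatrix hk A B C D = blockMatrix hk A' B' C' D' ↔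
      A = A' ∧ B = B' ∧ C = C' ∧ D = D' := by
  simp only [blockMatrix, (Matrix.reindex _ _).injective.eq_iff, fromBlocks_inj]

theorem exists_eq_blockMatrix (M : Matrix (Fin n) (Fin n) ℝ) :
    ∃ A B C D, M = blockMatrix hk A B C D := by
  let e : Fin k ⊕ Fin (n - k) ≃ Fin n :=
    finSumFinEquiv.trans (finCongr (Nat.add_sub_of_le hk))
  let N := (Matrix.reindex e e).symm M
  refine ⟨N.toBlocks₁₁, N.toBlocks₁₂, N.toBlocks₂₁, N.toBlocks₂₂, ?_⟩
  change M = Matrix.reindex e e _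
  rw [fromBlocks_toBlocks, Equiv.apply_symm_apply]

/-- After conjugation by V, anticommuting with diag(I, -I) kills the diagonal blocks (they appear as
2A and -2D), and symmetry of X ties the other two together. -/
theorem mem_tangentSpace_iff_exists_blockMatrix {Q : SymMat n} (hQ : Q ∈ involutionGr k n)
    {V : Matrix (Fin n) (Fin n) ℝ} (hV : V ∈ orthogonalGroup (Fin n) ℝ)
    (hQV : SymMat.toMatrix Q = V * blockMatrix hk 1 0 0 (-1) * Vᵀ) (X : SymMat n) :
    X ∈ tangentSpace (involutionGr k n) Q ↔
      ∃ X₀ : Matrix (Fin k) (Fin (n - k)) ℝ,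
        SymMat.toMatrix X = V * blockMatrix hk 0 X₀ X₀ᵀ 0 * Vᵀ := by
  have hV1 : V * Vᵀ = 1 := (mem_orthogonalGroup_iff (Fin n) ℝ).1 hV
  have hV2 : Vᵀ * V = 1 := (mem_orthogonalGroup_iff' (Fin n) ℝ).1 hV
  have hmul (A B : Matrix (Fin n) (Fin n) ℝ) : V * A * Vᵀ * (V * B * Vᵀ) = V * (A * B) * Vᵀ := by
    calc _ = V * A * (Vᵀ * V) * B * Vᵀ := by simp only [mul_assoc]
      _ = _ := by rw [hV2, mul_one, mul_assoc V A B]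
  rw [SymMat.mem_tangentSpace_iff hQ, SymMat.jordan_eq_zero_iff, hQV]
  constructor
  · intro h
    obtain ⟨A, B, C, D, hM⟩ := exists_eq_blockMatrix hk (Vᵀ * SymMat.toMatrix X * V)
    have hX : SymMat.toMatrix X = V * blockMatrix hk A B C D * Vᵀ := by
      rw [← hM, ← mul_assoc, ← mul_assoc, hV1, one_mul, mul_assoc, hV1, mul_one]
    have hinj {M : Matrix (Fin n) (Fin n) ℝ} (h0 : V * M * Vᵀ = 0) : M = 0 := by
      have h1 : Vᵀ * (V * M * Vᵀ) * V = M := by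
        rw [← mul_assoc, ← mul_assoc, hV2, one_mul, mul_assoc, hV2, mul_one]
      rw [← h1, h0, mul_zero, zero_mul]
    rw [hX, hmul, hmul, ← add_mul, ← mul_add] at h
    have h1 := hinj h
    rw [blockMatrix_mul, blockMatrix_mul, blockMatrix_add, ← blockMatrix_zero hk,
      blockMatrix_inj] at h1
    have hA : A = 0 := by simpa [← two_smul ℝ] using h1.1
    have hD : D = 0 := by
      have h2 : -D + -D = 0 := by simpa using h1.2.2.2
      simpa [← two_smul ℝ] using h2
    have hC : C = Bᵀ := by
      have h2 : (blockMatrix hk A B C D)ᵀ = blockMatrix hk A B C D := by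
        rw [← hM]
        simp only [transpose_mul, transpose_transpose, SymMat.transpose_toMatrix, mul_assoc]
      rw [transpose_blockMatrix, blockMatrix_inj] at h2
      exact h2.2.2.1.symm
    exact ⟨B, by rw [hX, hA, hD, hC]⟩
  · rintro ⟨X₀, hX⟩
    rw [hX, hmul, hmul, ← add_mul, ← mul_add, blockMatrix_mul, blockMatrix_mul, blockMatrix_add]
    simp [blockMatrix_zero]

/-- A real symmetric involution of trace `2k - n` is diagonalized, with the eigenvalues `1` first,
by an orthogonal matrix. -/
theorem exists_orthogonalGroup_blockMatrix {Q : SymMat n} (hQ : Q ∈ involutionGr k n) :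
    ∃ V ∈ orthogonalGroup (Fin n) ℝ,
      SymMat.toMatrix Q = V * blockMatrix hk 1 0 0 (-1) * Vᵀ := by
  have hH : (SymMat.toMatrix Q).IsHermitian := by
    rw [IsHermitian, conjTranspose_eq_transpose_of_trivial, SymMat.transpose_toMatrix]
  let U : Matrix (Fin n) (Fin n) ℝ := hH.eigenvectorUnitary.val
  let l := hH.eigenvalues
  have hU1 : U * Uᵀ = 1 := (mem_orthogonalGroup_iff (Fin n) ℝ).1 hH.eigenvectorUnitary.2
  have hU2 : Uᵀ * U = 1 := (mem_orthogonalGroup_iff' (Fin n) ℝ).1 hH.eigenvectorUnitary.2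
  have hspec : SymMat.toMatrix Q = U * diagonal l * Uᵀ := by
    have h := hH.spectral_theorem
    rw [Unitary.conjStarAlgAut_apply] at h
    exact h
  have hl2 (i : Fin n) : l i = 1 ∨ l i = -1 := by
    have h1 : diagonal l * diagonal l = 1 := by
      have h2 : diagonal l = Uᵀ * SymMat.toMatrix Q * U := by
        rw [hspec, ← mul_assoc, ← mul_assoc, hU2, one_mul, mul_assoc, hU2, mul_one]
      calc diagonal l * diagonal l
          = Uᵀ * (SymMat.toMatrix Q * (U * Uᵀ) * SymMat.toMatrix Q) * U := by
            rw [h2]; simp only [mul_assoc]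
        _ = 1 := by rw [hU1, mul_one, hQ.1, mul_one, hU2]
    rw [diagonal_mul_diagonal, diagonal_eq_one] at h1
    exact mul_self_eq_one_iff.1 (congrFun h1 i)
  -- All eigenvalues are ±1, so the trace is 2·#{i : l i = 1} - n.
  have hcard : Fintype.card {i // l i = 1} = k := by
    have h1 : ∑ i, l i = 2 * (k : ℝ) - n := by
      rw [← hQ.2, hspec, trace_mul_comm, ← mul_assoc, hU2, one_mul, trace_diagonal]
    have h2 : ∀ i, l i = 2 * (if l i = 1 then 1 else 0) - 1 := by
      intro i
      rcases hl2 i with h | h <;> rw [h] <;> norm_num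
    rw [Finset.sum_congr rfl fun i _ => h2 i, Finset.sum_sub_distrib, ← Finset.mul_sum,
      Finset.sum_boole] at h1
    rw [Fintype.card_subtype]
    simpa using h1
  have hcard' : Fintype.card {i // ¬ l i = 1} = n - k := by
    rw [Fintype.card_subtype_compl, hcard, Fintype.card_fin]
  let f : Fin k ⊕ Fin (n - k) ≃ Fin n :=
    ((Fintype.equivFinOfCardEq hcard).symm.sumCongr (Fintype.equivFinOfCardEq hcard').symm).trans
      (Equiv.sumCompl fun i => l i = 1)
  let e : Fin k ⊕ Fin (n - k) ≃ Fin n :=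
    finSumFinEquiv.trans (finCongr (Nat.add_sub_of_le hk))
  -- A permutation placing the indices of eigenvalue 1 first; applied to the columns of U alone, it
  -- keeps U orthogonal.
  let s : Fin n ≃ Fin n := e.symm.trans f
  have hblock : (diagonal l).submatrix s s = blockMatrix hk 1 0 0 (-1) := by
    have h1 : (diagonal l).submatrix f f = fromBlocks 1 0 0 (-1) := by
      have h2 : l ∘ f = Sum.elim (fun _ => 1) (fun _ => -1) := by
        funext i
        rcases i with i | i
        · exact ((Fintype.equivFinOfCardEq hcard).symm i).2
        · exact (hl2 _).resolve_left ((Fintype.equivFinOfCardEq hcard').symm i).2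
      rw [submatrix_diagonal_equiv, h2, ← fromBlocks_diagonal, diagonal_one,
        ← diagonal_neg, diagonal_one]
    change _ = (fromBlocks 1 0 0 (-1)).submatrix e.symm e.symm
    rw [← h1, submatrix_submatrix]
    rfl
  refine ⟨U.submatrix id s, ?_, ?_⟩
  · rw [mem_orthogonalGroup_iff']
    change (U.submatrix id s)ᵀ * U.submatrix id s = 1
    rw [transpose_submatrix, submatrix_mul _ _ _ _ _ Function.bijective_id |>.symm, hU2,
      submatrix_one_equiv]
  · rw [← hblock, transpose_submatrix, submatrix_mul_equiv, submatrix_mul_equiv, hspec,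
      submatrix_id_id]

end Block

open Matrix in
theorem theorem2p1 (k n : ℕ) (hk : k ≤ n) (Q : SymMat n) (hQ : Q ∈ involutionGr k n) :
    (∃ V ∈ orthogonalGroup (Fin n) ℝ,
      SymMat.toMatrix Q = V * blockMatrix hk 1 0 0 (-1) * Vᵀ) ∧
    ∀ V ∈ orthogonalGroup (Fin n) ℝ,
      SymMat.toMatrix Q = V * blockMatrix hk 1 0 0 (-1) * Vᵀ →
      (∀ X : SymMat n, X ∈ tangentSpace (involutionGr k n) Q ↔
        ∃ X₀ : Matrix (Fin k) (Fin (n - k)) ℝ,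
          SymMat.toMatrix X = V * blockMatrix hk 0 X₀ X₀ᵀ 0 * Vᵀ) ∧
      ∀ (X Y : SymMat n) (X₀ Y₀ : Matrix (Fin k) (Fin (n - k)) ℝ),
        SymMat.toMatrix X = V * blockMatrix hk 0 X₀ X₀ᵀ 0 * Vᵀ →
        SymMat.toMatrix Y = V * blockMatrix hk 0 Y₀ Y₀ᵀ 0 * Vᵀ →
        SecondFundamentalFormWellDefined (involutionGr k n) Q X Y ∧
        (∃ L : SymMat n →L[ℝ] SymMat n, HasGaussDifferential (involutionGr k n) Q X L ∧
          L Y = secondFundamentalForm (involutionGr k n) Q X Y) ∧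
        SymMat.toMatrix (secondFundamentalForm (involutionGr k n) Q X Y) =
          (1 / 2 : ℝ) • (V * blockMatrix hk (-(X₀ * Y₀ᵀ + Y₀ * X₀ᵀ)) 0
            0 (X₀ᵀ * Y₀ + Y₀ᵀ * X₀) * Vᵀ) := by
  refine ⟨exists_orthogonalGroup_blockMatrix hk hQ, fun V hV hQV => ?_⟩
  have htan := mem_tangentSpace_iff_exists_blockMatrix hk hQ hV hQV
  refine ⟨htan, fun X Y X₀ Y₀ hX hY => ?_⟩
  have hXT := (htan X).2 ⟨X₀, hX⟩
  have hYT := (htan Y).2 ⟨Y₀, hY⟩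
  refine ⟨SymMat.secondFundamentalFormWellDefined hQ hXT hYT,
    ⟨_, SymMat.hasGaussDifferential hQ hXT, (SymMat.secondFundamentalForm_eq hQ hXT hYT).symm⟩, ?_⟩
  have hV2 : Vᵀ * V = 1 := (mem_orthogonalGroup_iff' (Fin n) ℝ).1 hV
  have hmul (A B : Matrix (Fin n) (Fin n) ℝ) : V * A * Vᵀ * (V * B * Vᵀ) = V * (A * B) * Vᵀ := by
    calc _ = V * A * (Vᵀ * V) * B * Vᵀ := by simp only [mul_assoc]
      _ = _ := by rw [hV2, mul_one, mul_assoc V A B]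
  -- The factors VᵀV cancel, so -(QYX + XYQ)/2 is computed on the blocks.
  rw [SymMat.secondFundamentalForm_eq hQ hXT hYT, map_neg, SymMat.toMatrix_triple, ← smul_neg,
    hQV, hX, hY, hmul, hmul, hmul, hmul, ← add_mul, ← mul_add, ← neg_mul, ← mul_neg]
  simp only [blockMatrix_mul, blockMatrix_add, neg_blockMatrix]
  simp [add_comm]
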